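/- Let $X$ and $U$ be complex Hilbert spaces, let $A$ with domain $D(A)\subseteq X$ be the generator of a $C_0$-semigroup of contractions $(T(t))_{t\ge 0}$ on $X$, and let $B\colon U\to X$ be a bounded linear operator. Let $A_B=A-BB^*$ with domain $D(A_B)=D(A)$, and write $\sigma(\cdot)$ and $\rho(\cdot)$ for the spectrum and the resolvent set. Suppose that $A$ is skew-adjoint, that is, $A^*=-A$ with equal domains. Suppose further that $\sigma(A)$ consists of simple eigenvalues, so that $\dim\operatorname{Ker}(\lambda-A)=1$ for all $\lambda\in\sigma(A)$, and that these are uniformly separated, so that there exists $\delta>0$ with $|\lambda-\mu|\ge\delta$ for all distinct $\lambda,\mu\in\sigma(A)$. Let $\alpha>0$, and suppose that $i\mathbb{R}\subseteq\rho(A_B)$ and that there exists $C>0$ such that $$\|(is-A_B)^{-1}\|\le C\,(1+|s|^\alpha)\qquad\text{for all } s\in\mathbb{R}.$$ Then there exist $\tau>0$ and $c_\tau>0$ such that, with $\beta=\alpha/2$, $$c_\tau\,\|(I-A)^{-\beta}x_0\|^2\le\int_0^\tau\|B^*T(t)x_0\|^2\,\mathrm{d}t\qquad\text{for all } x_0\in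 X.$$ Here $(I-A)^{-\beta}$ is the bounded operator given by $(I-A)^{-\beta}x=\frac{1}{\Gamma(\beta)}\int_0^\infty t^{\beta-1}e^{-t}\,T(t)x\,\mathrm{d}t$ for $x\in X$. -/

import Mathlib

noncomputable section

open MeasureTheory Set Filter Topology

namespace SemiLinearDamping

/-- A `C₀`-semigroup of contractions `(T(t))_{t ≥ 0}` on a complex normed space `X`.
Only the values at times `t ≥ 0` carry meaning; those at negative times are never used. -/
structure ContractionSemigroup (X : Type*) [NormedAddCommGroup X] [NormedSpace ℂ X] where
  /-- the operator `T(t)` -/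
  op : ℝ → X →L[ℂ] X
  op_zero : op 0 = ContinuousLinearMap.id ℂ X
  op_add : ∀ s t : ℝ, 0 ≤ s → 0 ≤ t → op (s + t) = (op s).comp (op t)
  norm_op_le : ∀ t : ℝ, 0 ≤ t → ‖op t‖ ≤ 1
  continuousOn_op : ∀ x : X, ContinuousOn (fun t : ℝ => op t x) (Ici 0)

section Operators

variable {X : Type*} [NormedAddCommGroup X] [NormedSpace ℂ X]

/-- `A` is the infinitesimal generator of `T`: we have `x ∈ D(A)` and `A x = y` if and only if
`(T(t) x - x) / t → y` as `t → 0+`. -/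
def IsGenerator (A : X →ₗ.[ℂ] X) (T : ContractionSemigroup X) : Prop :=
  ∀ x y : X, (x, y) ∈ A.graph ↔
    Tendsto (fun t : ℝ => (t : ℂ)⁻¹ • (T.op t x - x)) (𝓝[>] 0) (𝓝 y)

/-- The operator `z - A`, defined on `D(A)`. -/
def zSub (A : X →ₗ.[ℂ] X) (z : ℂ) : A.domain →ₗ[ℂ] X :=
  z • A.domain.subtype - A.toFun

/-- `R` is a bounded two-sided inverse of `z - A : D(A) → X`. -/
def IsResolventAt (A : X →ₗ.[ℂ] X) (z : ℂ) (R : X →L[ℂ] X) : Prop :=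
  (∀ y : X, ∃ h : R y ∈ A.domain, zSub A z ⟨R y, h⟩ = y) ∧
    ∀ x : A.domain, R (zSub A z x) = x

/-- The resolvent set `ρ(A)`: the `z` such that `z - A : D(A) → X` is bijective with bounded
inverse. -/
def resolventSet (A : X →ₗ.[ℂ] X) : Set ℂ :=
  {z | ∃ R : X →L[ℂ] X, IsResolventAt A z R}

/-- The spectrum `σ(A)`. -/
def spectrumSet (A : X →ₗ.[ℂ] X) : Set ℂ :=
  (resolventSet A)ᶜ

open scoped Classical in
/-- The resolvent `(z - A)⁻¹` for `z ∈ ρ(A)` (and `0` for the other `z`). -/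
def resolventOp (A : X →ₗ.[ℂ] X) (z : ℂ) : X →L[ℂ] X :=
  if h : ∃ R : X →L[ℂ] X, IsResolventAt A z R then h.choose else 0

theorem isResolventAt_resolventOp {A : X →ₗ.[ℂ] X} {z : ℂ} (hz : z ∈ resolventSet A) :
    IsResolventAt A z (resolventOp A z) := by
  have h : ∃ R : X →L[ℂ] X, IsResolventAt A z R := hz
  rw [resolventOp, dif_pos h]
  exact h.choose_spec

theorem IsResolventAt.eq_resolventOp {A : X →ₗ.[ℂ] X} {z : ℂ} {R : X →L[ℂ] X}
    (hR : IsResolventAt A z R) : R = resolventOp A z := by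
  have h := isResolventAt_resolventOp (A := A) (z := z) ⟨R, hR⟩
  ext y
  obtain ⟨hd, hy⟩ := h.1 y
  have := hR.2 ⟨_, hd⟩
  rwa [hy] at this

/-- `σ(A)` consists of simple eigenvalues: for every `z ∈ σ(A)` the space `Ker (z - A)` is
one-dimensional. -/
def SpectrumSimpleEigenvalues (A : X →ₗ.[ℂ] X) : Prop :=
  ∀ z ∈ spectrumSet A, Module.finrank ℂ (LinearMap.ker (zSub A z)) = 1

/-- The points of `σ(A)` are uniformly separated. -/
def SpectrumUniformlySeparated (A : X →ₗ.[ℂ] X) : Prop :=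
  ∃ δ : ℝ, 0 < δ ∧ ∀ z ∈ spectrumSet A, ∀ w ∈ spectrumSet A, z ≠ w → δ ≤ ‖z - w‖

/-- The negative fractional power `(I - A)^{-β}`, `β > 0`, where `A` generates `T`. As `A - I`
generates the exponentially stable semigroup `e^{-t} T(t)`, it is given by
`(I - A)^{-β} x = Γ(β)⁻¹ ∫₀^∞ t^{β-1} e^{-t} T(t) x dt`. -/
def negFracPow (T : ContractionSemigroup X) (β : ℝ) (x : X) : X :=
  (Real.Gamma β)⁻¹ • ∫ t in Ioi (0 : ℝ), (t ^ (β - 1) * Real.exp (-t)) • T.op t x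

/-- The integral in `negFracPow` converges absolutely. -/
theorem integrableOn_negFracPow (T : ContractionSemigroup X) {β : ℝ} (hβ : 0 < β) (x : X) :
    IntegrableOn (fun t : ℝ => (t ^ (β - 1) * Real.exp (-t)) • T.op t x) (Ioi 0) := by
  have hg : IntegrableOn (fun t : ℝ => Real.exp (-t) * t ^ (β - 1)) (Ioi 0) :=
    Real.GammaIntegral_convergent hβ
  have hg' : IntegrableOn (fun t : ℝ => t ^ (β - 1) * Real.exp (-t)) (Ioi 0) := by
    simpa only [mul_comm] using hg
  have hm : AEStronglyMeasurable (fun t : ℝ => T.op t x) (volume.restrict (Ioi 0)) :=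
    ((T.continuousOn_op x).mono Ioi_subset_Ici_self).aestronglyMeasurable measurableSet_Ioi
  refine Integrable.mono' (hg'.mul_const ‖x‖) (hg'.aestronglyMeasurable.smul hm) ?_
  filter_upwards [ae_restrict_mem measurableSet_Ioi] with t ht
  have ht' : (0 : ℝ) < t := ht
  have h0 : 0 ≤ t ^ (β - 1) * Real.exp (-t) := by positivity
  have h1 : ‖T.op t x‖ ≤ ‖x‖ := by
    simpa using (T.op t).le_of_opNorm_le (T.norm_op_le t ht'.le) x
  rw [norm_smul, Real.norm_of_nonneg h0]
  exact mul_le_mul_of_nonneg_left h1 h0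

end Operators

section Hilbert

variable {X U : Type*} [NormedAddCommGroup X] [InnerProductSpace ℂ X] [CompleteSpace X]
  [NormedAddCommGroup U] [InnerProductSpace ℂ U] [CompleteSpace U]

/-- `A` is skew-adjoint: it is densely defined and `A* = -A` (with equality of domains). -/
def IsSkewAdjointOp (A : X →ₗ.[ℂ] X) : Prop :=
  Dense (A.domain : Set X) ∧ A.adjoint = -A

/-- The operator `A_B = A - B B*` with domain `D(A_B) = D(A)`. -/
def dampedOp (A : X →ₗ.[ℂ] X) (B : U →L[ℂ] X) : X →ₗ.[ℂ] X where
  domain := A.domain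
  toFun := A.toFun - (B.comp (ContinuousLinearMap.adjoint B)).toLinearMap.comp A.domain.subtype

end Hilbert

end SemiLinearDamping

end

/-! The estimate is proved on finite sums of eigenvectors of `A` and extended by density. The
eigenvalues of the skew-adjoint operator `A` are imaginary, eigenvectors for different eigenvalues
are orthogonal, and if `A φ = is φ` then `T(t) φ = e^{ist} φ`.

**Eigenvectors are total** (`IsSkewAdjointOp.dense_iSup_imEigenspace`). The resolvent `(1 - A)⁻¹` is a
bounded normal operator, and since `σ(A)` is uniformly separated its spectrum accumulates only
at `0`. The continuous functional calculus makes it a norm limit of finite combinations of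
operators with values in eigenspaces, and its range `D(A)` is dense.

**Damping on eigenvectors** (`IsSkewAdjointOp.norm_sq_le_mul`). With `R = (is - A_B)⁻¹` we
have `φ = R B B* φ`, and dissipativity of `A_B*` gives `‖B* R*‖² ≤ ‖R‖`. Hence
`‖φ‖² ≤ ‖R‖ ‖B* φ‖² ≤ C (1 + |s|^α) ‖B* φ‖²`.

**Ingham's inequality** (`ingham_inequality`). For exponents separated by `δ` and `τ` large,
`∫₀^τ ‖∑ e^{ist} w_s‖² dt ≥ (τ/3) ∑ ‖w_s‖²` for vectors `w_s` of a Hilbert space.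

For a finite sum `x = ∑ φ_s` of eigenvectors, Ingham's inequality with `w_s = B* φ_s`, the
bound on `‖B* φ_s‖`, and the fact that `(I - A)^{-α/2}` multiplies `φ_s` by `(1 - is)^{-α/2}` give the
estimate with `c = τ / (6 C)` (`IsSkewAdjointOp.observability_sum`). Both sides are continuous
in `x`, so it extends to all of `X`. -/

noncomputable section

open MeasureTheory Set Filter Topology

namespace SemiLinearDamping

/-! ### Resolvents -/

section Resolvent

variable {X : Type*} [NormedAddCommGroup X] [NormedSpace ℂ X] {A : X →ₗ.[ℂ] X}

theorem zSub_apply (z : ℂ) (x : A.domain) : zSub A z x = z • (x : X) - A x := rfl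

/-- The resolvent identity. -/
theorem IsResolventAt.eq_add {z w : ℂ} {R S : X →L[ℂ] X}
    (hR : IsResolventAt A z R) (hS : IsResolventAt A w S) (y : X) :
    R y = S y + (w - z) • S (R y) := by
  obtain ⟨hd, hy⟩ := hR.1 y
  have h := hS.2 ⟨R y, hd⟩
  have h2 : zSub A w ⟨R y, hd⟩ = y + (w - z) • R y := by
    nth_rewrite 2 [← hy]
    rw [zSub_apply, zSub_apply]; module
  rw [h2, map_add, map_smul] at h
  exact h.symm

/-- Spectral mapping for the resolvent `R = (w - A)⁻¹`, away from `0`. -/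
theorem IsResolventAt.sub_inv_mem_spectrumSet {w : ℂ} {R : X →L[ℂ] X}
    (hR : IsResolventAt A w R) {μ : ℂ} (hμ : μ ≠ 0) (h : μ ∈ spectrum ℂ R) :
    w - μ⁻¹ ∈ spectrumSet A := by
  by_contra hc
  rw [spectrumSet, mem_compl_iff, not_not] at hc
  obtain ⟨S, hS⟩ := hc
  rw [spectrum.mem_iff] at h
  have e1 := fun y => hR.eq_add hS y
  have e2 := fun y => hS.eq_add hR y
  apply h
  rw [isUnit_iff_exists]
  refine ⟨μ⁻¹ • (1 + μ⁻¹ • S), ?_, ?_⟩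
  · ext y
    have := e2 y
    rw [sub_sub_cancel] at this
    simp only [Algebra.algebraMap_eq_smul_one, mul_apply_eq_comp,
      sub_apply, smul_apply, add_apply,
      one_apply_eq_self, map_smul, map_add]
    nth_rewrite 1 [this]
    match_scalars <;> field_simp <;> ring
  · ext y
    have := e1 y
    rw [sub_sub_cancel_left] at this
    simp only [Algebra.algebraMap_eq_smul_one, mul_apply_eq_comp,
      sub_apply, smul_apply, add_apply,
      one_apply_eq_self, map_smul, map_sub]
    nth_rewrite 1 [this]
    match_scalars <;> field_simp <;> ring

end Resolvent

/-! ### Skew-adjoint operators -/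

section InnerProduct

variable {V : Type*} [NormedAddCommGroup V] [InnerProductSpace ℂ V]

theorem inner_self_eq_ofReal (v : V) : inner ℂ v v = ((‖v‖ ^ 2 : ℝ) : ℂ) := by
  rw [Complex.ofReal_pow]; exact inner_self_eq_norm_sq_to_K v

end InnerProduct

section SkewAdjoint

variable {X : Type*} [NormedAddCommGroup X] [InnerProductSpace ℂ X] [CompleteSpace X]
  {A : X →ₗ.[ℂ] X}

theorem IsSkewAdjointOp.inner_apply_left (hA : IsSkewAdjointOp A) (x y : A.domain) :
    inner ℂ (A x) (y : X) = -inner ℂ (x : X) (A y) := by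
  have h := LinearPMap.adjoint_isFormalAdjoint hA.1
  rw [hA.2] at h
  have h := h x y
  rw [LinearPMap.neg_apply, inner_neg_left] at h
  rw [← h, neg_neg]

/-- The inclusion `D(A†) ⊆ D(-A)`. -/
theorem IsSkewAdjointOp.exists_apply_eq (hA : IsSkewAdjointOp A) {y w : X}
    (h : ∀ x : A.domain, inner ℂ w (x : X) = inner ℂ y (A x)) :
    ∃ hy : y ∈ A.domain, A ⟨y, hy⟩ = -w := by
  have hy := LinearPMap.mem_adjoint_domain_of_exists y ⟨w, h⟩
  have hw := LinearPMap.adjoint_apply_eq hA.1 ⟨y, hy⟩ h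
  have hg : (y, w) ∈ A.adjoint.graph := by
    rw [LinearPMap.mem_graph_iff]; exact ⟨⟨y, hy⟩, rfl, hw⟩
  rw [hA.2, LinearPMap.mem_graph_iff] at hg
  obtain ⟨y', h1, h2⟩ := hg
  obtain ⟨y', hy'⟩ := y'
  obtain rfl : y' = y := h1
  refine ⟨hy', ?_⟩
  have h3 : (-A) ⟨y', hy'⟩ = w := h2
  rw [← h3, LinearPMap.neg_apply, neg_neg]

/-- `A` is the negative of its own adjoint, and adjoints are closed. -/
theorem IsSkewAdjointOp.isClosed (hA : IsSkewAdjointOp A) : A.IsClosed := by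
  have h := LinearPMap.adjoint_isClosed hA.1
  rw [hA.2] at h
  have h2 : (A.graph : Set (X × X)) =
      (fun p : X × X => (p.1, -p.2)) ⁻¹' ((-A).graph : Set (X × X)) := by
    ext ⟨x, y⟩
    simp only [SetLike.mem_coe, mem_preimage, LinearPMap.mem_graph_iff]
    constructor
    · rintro ⟨u, hu, hy⟩; exact ⟨u, hu, by rw [LinearPMap.neg_apply, hy]⟩
    · rintro ⟨u, hu, hy⟩
      exact ⟨u, hu, by rw [LinearPMap.neg_apply] at hy; exact neg_injective hy⟩
  have h3 : IsClosed ((-A).graph : Set (X × X)) := h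
  change IsClosed (A.graph : Set (X × X))
  rw [h2]
  exact h3.preimage (by fun_prop)

theorem IsSkewAdjointOp.re_inner_apply (hA : IsSkewAdjointOp A) (x : A.domain) :
    (inner ℂ (x : X) (A x)).re = 0 := by
  have h := hA.inner_apply_left x x
  have h2 := congrArg Complex.re h
  rw [← inner_conj_symm, Complex.conj_re, Complex.neg_re] at h2
  linarith

theorem IsSkewAdjointOp.re_inner_zSub (hA : IsSkewAdjointOp A) (z : ℂ) (x : A.domain) :
    (inner ℂ (x : X) (zSub A z x)).re = z.re * ‖(x : X)‖ ^ 2 := by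
  rw [zSub_apply, inner_sub_right, Complex.sub_re, hA.re_inner_apply, inner_smul_right,
    inner_self_eq_ofReal, sub_zero]
  exact Complex.re_mul_ofReal z (‖(x : X)‖ ^ 2)

theorem IsSkewAdjointOp.mul_norm_le (hA : IsSkewAdjointOp A) (z : ℂ) (x : A.domain) :
    |z.re| * ‖(x : X)‖ ≤ ‖zSub A z x‖ := by
  rcases eq_or_lt_of_le (norm_nonneg (x : X)) with h | h
  · rw [← h, mul_zero]; exact norm_nonneg _
  · have h1 := hA.re_inner_zSub z x
    have h2 : |(inner ℂ (x : X) (zSub A z x)).re| ≤ ‖(x : X)‖ * ‖zSub A z x‖ :=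
      (Complex.abs_re_le_norm _).trans (norm_inner_le_norm _ _)
    rw [h1, abs_mul, abs_of_nonneg (sq_nonneg ‖(x : X)‖)] at h2
    refine le_of_mul_le_mul_left ?_ h
    linarith [h2]

/-- The resolvent set of a skew-adjoint operator contains the complement of the imaginary axis:
the range of `z - A` is closed by the lower bound `|re z| ‖x‖ ≤ ‖(z - A) x‖` and the closedness of
`A`, and a vector orthogonal to it is an eigenvector of `A` for the eigenvalue `-conj z`. -/
theorem IsSkewAdjointOp.mem_resolventSet (hA : IsSkewAdjointOp A) {z : ℂ} (hz : z.re ≠ 0) :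
    z ∈ resolventSet A := by
  have hz' : 0 < |z.re| := abs_pos.mpr hz
  have hinj : Function.Injective (zSub A z) := by
    rw [← LinearMap.ker_eq_bot, LinearMap.ker_eq_bot']
    intro x hx
    have := hA.mul_norm_le z x
    rw [hx, norm_zero] at this
    have h0 : ‖(x : X)‖ = 0 := by nlinarith [norm_nonneg (x : X)]
    exact Subtype.ext (norm_eq_zero.mp h0)
  have hclosed : IsClosed (LinearMap.range (zSub A z) : Set X) := by
    rw [← isSeqClosed_iff_isClosed]
    intro u y hu huy
    choose x hx using hu
    have hcau : CauchySeq fun n => ((x n : A.domain) : X) := by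
      have hu := huy.cauchySeq
      rw [Metric.cauchySeq_iff] at hu ⊢
      intro ε hε
      obtain ⟨N, hN⟩ := hu (|z.re| * ε) (by positivity)
      refine ⟨N, fun m hm n hn => ?_⟩
      have h1 := hN m hm n hn
      have h2 := hA.mul_norm_le z (x m - x n)
      rw [map_sub, hx, hx, ← dist_eq_norm] at h2
      rw [dist_eq_norm]
      exact lt_of_mul_lt_mul_left (h2.trans_lt h1) hz'.le
    obtain ⟨a, ha⟩ := cauchySeq_tendsto_of_complete hcau
    have hAx : Tendsto (fun n => A (x n)) atTop (𝓝 (z • a - y)) := by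
      refine ((ha.const_smul z).sub huy).congr fun n => ?_
      rw [← hx n, zSub_apply]; abel
    have hmem : (a, z • a - y) ∈ (A.graph : Set (X × X)) :=
      IsClosed.mem_of_tendsto hA.isClosed (ha.prodMk_nhds hAx)
        (Eventually.of_forall fun n => LinearPMap.mem_graph A (x n))
    rw [SetLike.mem_coe, LinearPMap.mem_graph_iff] at hmem
    obtain ⟨a', h1, h2⟩ := hmem
    refine ⟨a', ?_⟩
    rw [zSub_apply, h2, h1]; simp
  have hsurj : LinearMap.range (zSub A z) = ⊤ := by
    have hperp : (LinearMap.range (zSub A z))ᗮ = ⊥ := by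
      rw [Submodule.eq_bot_iff]
      intro y hy
      rw [Submodule.mem_orthogonal'] at hy
      have hy' : ∀ x : A.domain,
          inner ℂ (starRingEnd ℂ z • y) (x : X) = inner ℂ y (A x) := fun x => by
        have := hy _ ⟨x, rfl⟩
        rw [zSub_apply, inner_sub_right, inner_smul_right, sub_eq_zero] at this
        rw [inner_smul_left, Complex.conj_conj, this]
      obtain ⟨hyd, hyA⟩ := hA.exists_apply_eq hy'
      have h3 := hA.re_inner_zSub (-starRingEnd ℂ z) ⟨y, hyd⟩
      rw [zSub_apply, hyA] at h3
      have h4 : -starRingEnd ℂ z • y - -(starRingEnd ℂ z • y) = 0 := by module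
      rw [h4, inner_zero_right, Complex.neg_re, Complex.conj_re, Complex.zero_re] at h3
      have h5 : ‖y‖ ^ 2 = 0 := by
        rcases mul_eq_zero.mp h3.symm with h | h
        · exact absurd (neg_eq_zero.mp h) hz
        · exact h
      exact norm_eq_zero.mp (pow_eq_zero_iff two_ne_zero |>.mp h5)
    rw [← Submodule.topologicalClosure_eq_top_iff] at hperp
    rwa [hclosed.submodule_topologicalClosure_eq] at hperp
  let e := LinearEquiv.ofBijective (zSub A z) ⟨hinj, LinearMap.range_eq_top.mp hsurj⟩
  refine ⟨(A.domain.subtype ∘ₗ e.symm.toLinearMap).mkContinuous |z.re|⁻¹ fun y => ?_, ?_, ?_⟩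
  · have h := hA.mul_norm_le z (e.symm y)
    have h2 : zSub A z (e.symm y) = y := e.apply_symm_apply y
    rw [h2] at h
    rw [inv_mul_eq_div, le_div_iff₀' hz']
    exact h
  · intro y
    exact ⟨(e.symm y).2, e.apply_symm_apply y⟩
  · intro x
    exact congrArg Subtype.val (e.symm_apply_apply x)

/-- The resolvents of a skew-adjoint operator off the imaginary axis are normal, as the adjoint
of `(1 - A)⁻¹` is `-(-1 - A)⁻¹`. -/
theorem IsSkewAdjointOp.isStarNormal (hA : IsSkewAdjointOp A) {R : X →L[ℂ] X}
    (hR : IsResolventAt A 1 R) : IsStarNormal R := by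
  obtain ⟨S, hS⟩ := hA.mem_resolventSet (z := -1) (by simp)
  have hstar : star R = -S := by
    rw [ContinuousLinearMap.star_eq_adjoint]
    refine ((ContinuousLinearMap.eq_adjoint_iff (-S) R).mpr fun y x => ?_).symm
    obtain ⟨hx, hx'⟩ := hR.1 x
    obtain ⟨hy, hy'⟩ := hS.1 y
    rw [zSub_apply] at hx' hy'
    have h := hA.inner_apply_left ⟨S y, hy⟩ ⟨R x, hx⟩
    conv_rhs => rw [← hy']
    conv_lhs => rw [← hx']
    simp only [neg_apply, inner_sub_left, inner_sub_right, inner_neg_left, h,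
      inner_smul_left, inner_smul_right]
    simp
  have hcomm : R * S = S * R := by
    ext y
    have h1 := hR.eq_add hS y
    have h2 := hS.eq_add hR y
    rw [h2, add_assoc, left_eq_add] at h1
    have h3 : (2 : ℂ) • (R (S y) - S (R y)) = 0 := by
      rw [← h1]; module
    have h4 := (smul_eq_zero.mp h3).resolve_left two_ne_zero
    exact sub_eq_zero.mp h4
  refine ⟨?_⟩
  rw [hstar]
  change -S * R = R * -S
  rw [neg_mul, mul_neg, hcomm]

end SkewAdjoint

/-! ### Completeness of the eigenvectors -/

section Eigenvectors

variable {X : Type*} [NormedAddCommGroup X] [InnerProductSpace ℂ X]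

/-- The space `Ker (is - A)`, as a subspace of `X`; it is trivial unless `is` is an eigenvalue. -/
def imEigenspace (A : X →ₗ.[ℂ] X) (s : ℝ) : Submodule ℂ X :=
  (LinearMap.ker (zSub A (Complex.I * s))).map A.domain.subtype

variable {A : X →ₗ.[ℂ] X}

theorem mem_imEigenspace_iff {s : ℝ} {x : X} :
    x ∈ imEigenspace A s ↔ ∃ h : x ∈ A.domain, A ⟨x, h⟩ = (Complex.I * s) • x := by
  rw [imEigenspace, Submodule.mem_map]
  constructor
  · rintro ⟨y, hy, rfl⟩
    rw [LinearMap.mem_ker, zSub_apply, sub_eq_zero] at hy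
    exact ⟨y.2, hy.symm⟩
  · rintro ⟨h, hx⟩
    refine ⟨⟨x, h⟩, ?_, rfl⟩
    rw [LinearMap.mem_ker, zSub_apply, hx, sub_self]

theorem mem_spectrumSet_of_mem_imEigenspace {s : ℝ} {x : X} (hx : x ∈ imEigenspace A s)
    (h0 : x ≠ 0) : Complex.I * s ∈ spectrumSet A := by
  rintro ⟨R, hR⟩
  obtain ⟨h, hA⟩ := mem_imEigenspace_iff.mp hx
  have := hR.2 ⟨x, h⟩
  rw [zSub_apply, hA, sub_self, map_zero] at this
  exact h0 this.symm

/-- If the spectrum of `A` is uniformly separated, the nonzero points of the spectrum of the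
resolvent are isolated. -/
theorem eventually_eq_of_mem_spectrum (hsep : SpectrumUniformlySeparated A) {R : X →L[ℂ] X}
    (hR : IsResolventAt A 1 R) {μ : ℂ} (hμ : μ ≠ 0) (hμR : μ ∈ spectrum ℂ R) :
    ∀ᶠ ν in 𝓝[spectrum ℂ R] μ, ν = μ := by
  obtain ⟨δ, hδ, h⟩ := hsep
  have hc : ContinuousAt (fun ν : ℂ => (1 - ν⁻¹) - (1 - μ⁻¹)) μ := by
    fun_prop (disch := assumption)
  have h1 : ∀ᶠ ν in 𝓝 μ, ‖(1 - ν⁻¹) - (1 - μ⁻¹)‖ < δ :=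
    hc.norm.eventually_lt_const (by simpa using hδ)
  filter_upwards [nhdsWithin_le_nhds h1, nhdsWithin_le_nhds (eventually_ne_nhds hμ),
    self_mem_nhdsWithin] with ν h2 h3 h4
  by_contra hne
  have := h _ (hR.sub_inv_mem_spectrumSet h3 h4) _ (hR.sub_inv_mem_spectrumSet hμ hμR)
    (fun h => hne (inv_injective (sub_right_injective h)))
  linarith

variable [CompleteSpace X]

theorem IsSkewAdjointOp.inner_eq_zero (hA : IsSkewAdjointOp A) {s r : ℝ} (hsr : s ≠ r) {x y : X}
    (hx : x ∈ imEigenspace A s) (hy : y ∈ imEigenspace A r) : inner ℂ x y = 0 := by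
  obtain ⟨hx, hx'⟩ := mem_imEigenspace_iff.mp hx
  obtain ⟨hy, hy'⟩ := mem_imEigenspace_iff.mp hy
  have h := hA.inner_apply_left ⟨x, hx⟩ ⟨y, hy⟩
  rw [hx', hy', inner_smul_left, inner_smul_right] at h
  simp only [map_mul, Complex.conj_I, Complex.conj_ofReal] at h
  have h2 : Complex.I * ((s : ℂ) - r) * inner ℂ x y = 0 := by linear_combination -h
  have h3 : (s : ℂ) - r ≠ 0 := sub_ne_zero.mpr (by exact_mod_cast hsr)
  simpa [h3, Complex.I_ne_zero] using h2

/-- An eigenvector of the resolvent is an eigenvector of `A`, for an imaginary eigenvalue. -/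
theorem IsSkewAdjointOp.mem_iSup_imEigenspace (hA : IsSkewAdjointOp A) {R : X →L[ℂ] X}
    (hR : IsResolventAt A 1 R) {μ : ℂ} (hμ : μ ≠ 0) {x : X} (hx : R x = μ • x) :
    x ∈ ⨆ s, imEigenspace A s := by
  rcases eq_or_ne x 0 with rfl | h0
  · exact zero_mem _
  obtain ⟨hd, hy⟩ := hR.1 x
  have hx2 : x = μ⁻¹ • R x := by rw [hx, inv_smul_smul₀ hμ]
  have hxd : x ∈ A.domain := by rw [hx2]; exact A.domain.smul_mem _ hd
  have hz : zSub A 1 ⟨x, hxd⟩ = μ⁻¹ • x := by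
    have h : (⟨x, hxd⟩ : A.domain) = μ⁻¹ • ⟨R x, hd⟩ := Subtype.ext hx2
    rw [h, map_smul, hy]
  have hAx : A ⟨x, hxd⟩ = (1 - μ⁻¹) • x := by
    rw [zSub_apply, one_smul, sub_eq_iff_eq_add] at hz
    rw [sub_smul, one_smul, eq_sub_iff_add_eq, add_comm]
    exact hz.symm
  have hre := hA.re_inner_apply ⟨x, hxd⟩
  have hre' := hA.re_inner_zSub (1 - μ⁻¹) ⟨x, hxd⟩
  rw [zSub_apply, hAx, sub_self, inner_zero_right, Complex.zero_re] at hre'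
  have h1 : (1 - μ⁻¹).re = 0 :=
    (mul_eq_zero.mp hre'.symm).resolve_right (pow_ne_zero 2 (norm_ne_zero_iff.mpr h0))
  have h2 : Complex.I * ((1 - μ⁻¹).im : ℂ) = 1 - μ⁻¹ := by
    apply Complex.ext <;> simp [Complex.mul_re, Complex.mul_im] at h1 ⊢
    linarith
  exact Submodule.mem_iSup_of_mem (1 - μ⁻¹).im
    (mem_imEigenspace_iff.mpr ⟨hxd, by rw [hAx, h2]⟩)

open scoped Classical in
/-- The linear span of the eigenvectors is dense. The resolvent `R = (1 - A)⁻¹` is a normal operator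
whose spectrum accumulates at `0` only. By the continuous functional calculus, `R` is the norm limit
of finite sums `∑ μ P_μ`, where `P_μ` is the indicator function of the isolated point `μ ≠ 0` of the
spectrum, applied to `R`; as `(R - μ) P_μ = 0`, the range of `P_μ` consists of eigenvectors. -/
theorem IsSkewAdjointOp.dense_iSup_imEigenspace (hA : IsSkewAdjointOp A)
    (hsep : SpectrumUniformlySeparated A) :
    Dense ((⨆ s, imEigenspace A s : Submodule ℂ X) : Set X) := by
  obtain ⟨R, hR⟩ := hA.mem_resolventSet (z := 1) (by simp)
  have hN : IsStarNormal R := hA.isStarNormal hR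
  set M : Submodule ℂ X := ⨆ s, imEigenspace A s with hM
  let f : ℂ → ℂ → ℂ := fun μ z => if z = μ then 1 else 0
  have hf : ∀ μ ∈ spectrum ℂ R, μ ≠ 0 → ContinuousOn (f μ) (spectrum ℂ R) := by
    intro μ hμR hμ ν hν
    by_cases h : ν = μ
    · subst h
      refine (continuousWithinAt_const (b := (1 : ℂ))).congr_of_eventuallyEq ?_ (by simp [f])
      filter_upwards [eventually_eq_of_mem_spectrum hsep hR hμ hμR] with z hz
      simp [f, hz]
    · refine (continuousWithinAt_const (b := (0 : ℂ))).congr_of_eventuallyEq ?_ (by simp [f, h])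
      filter_upwards [nhdsWithin_le_nhds (eventually_ne_nhds h)] with z hz
      simp [f, hz]
  have hP : ∀ μ ∈ spectrum ℂ R, μ ≠ 0 → ∀ x, cfc (f μ) R x ∈ M := by
    intro μ hμR hμ x
    refine hA.mem_iSup_imEigenspace hR hμ ?_
    have h1 : R * cfc (f μ) R = μ • cfc (f μ) R := by
      have hc := hf μ hμR hμ
      rw [← cfc_smul μ (f μ) R hc]
      nth_rewrite 1 [← cfc_id ℂ R]
      rw [← cfc_mul id (f μ) R continuousOn_id hc]
      congr 1
      ext z
      by_cases hz : z = μ <;> simp [f, hz]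
    exact congrArg (fun L : X →L[ℂ] X => L x) h1
  have hRM : ∀ x, R x ∈ closure (M : Set X) := by
    intro x
    rw [Metric.mem_closure_iff]
    intro ε hε
    obtain ⟨η, hη, hηε⟩ : ∃ η : ℝ, 0 < η ∧ η * ‖x‖ < ε := by
      refine ⟨ε / (‖x‖ + 1), by positivity, ?_⟩
      rw [div_mul_eq_mul_div, div_lt_iff₀ (by positivity)]
      nlinarith
    have hfin : (spectrum ℂ R ∩ {z | η ≤ ‖z‖}).Finite := by
      refine ((spectrum.isCompact R).inter_right
        (isClosed_le continuous_const continuous_norm)).finite ?_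
      rw [isDiscrete_iff_forall_mem_exists_isOpen]
      rintro μ ⟨hμR, hμη⟩
      have hμ : μ ≠ 0 := norm_pos_iff.mp (hη.trans_le hμη)
      have h := eventually_eq_of_mem_spectrum hsep hR hμ hμR
      rw [eventually_nhdsWithin_iff, eventually_nhds_iff] at h
      obtain ⟨V, hV, hVo, hVμ⟩ := h
      refine ⟨V, hVo, ?_⟩
      ext z
      constructor
      · rintro ⟨h1, h2, -⟩; exact hV z h1 h2
      · rintro rfl; exact ⟨hVμ, hμR, hμη⟩
    set F : Finset ℂ := hfin.toFinset with hF
    have hFmem : ∀ μ, μ ∈ F ↔ μ ∈ spectrum ℂ R ∧ η ≤ ‖μ‖ := fun μ => by simp [hF]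
    have hF0 : ∀ μ ∈ F, μ ∈ spectrum ℂ R ∧ μ ≠ 0 := fun μ hμ =>
      ⟨((hFmem μ).mp hμ).1, norm_pos_iff.mp (hη.trans_le ((hFmem μ).mp hμ).2)⟩
    have hcont : ∀ μ ∈ F, ContinuousOn (fun z => μ • f μ z) (spectrum ℂ R) := fun μ hμ =>
      (hf μ (hF0 μ hμ).1 (hF0 μ hμ).2).const_smul μ
    have hcont' : ContinuousOn (∑ μ ∈ F, fun z => μ • f μ z) (spectrum ℂ R) := by
      rw [Finset.sum_fn]
      exact continuousOn_finsetSum F hcont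
    have hS : cfc (∑ μ ∈ F, fun z => μ • f μ z) R = ∑ μ ∈ F, μ • cfc (f μ) R := by
      rw [cfc_sum _ R F hcont]
      exact Finset.sum_congr rfl fun μ hμ => cfc_smul μ (f μ) R (hf μ (hF0 μ hμ).1 (hF0 μ hμ).2)
    have hnorm : ‖R - ∑ μ ∈ F, μ • cfc (f μ) R‖ ≤ η := by
      rw [← hS]
      nth_rewrite 1 [← cfc_id ℂ R]
      rw [← cfc_sub id _ R continuousOn_id hcont']
      refine norm_cfc_le hη.le fun z hz => ?_
      simp only [Finset.sum_apply, smul_eq_mul, f, mul_ite, mul_one, mul_zero, id,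
        Finset.sum_ite_eq]
      split_ifs with h
      · simpa using hη.le
      · rw [sub_zero]
        rw [hFmem, not_and, not_le] at h
        exact (h hz).le
    refine ⟨(∑ μ ∈ F, μ • cfc (f μ) R) x, ?_, ?_⟩
    · rw [sum_apply]
      refine M.sum_mem fun μ hμ => ?_
      exact M.smul_mem μ (hP μ (hF0 μ hμ).1 (hF0 μ hμ).2 x)
    · rw [dist_eq_norm]
      exact ((R - ∑ μ ∈ F, μ • cfc (f μ) R).le_of_opNorm_le hnorm x).trans_lt hηε
  have hdom : (A.domain : Set X) ⊆ closure (M : Set X) := by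
    intro x hx
    have h := hRM (zSub A 1 ⟨x, hx⟩)
    rwa [hR.2] at h
  exact dense_closure.mp (hA.1.mono hdom)

end Eigenvectors

/-! ### Ingham's inequality -/

section Ingham

theorem abs_floor_mul_le {δ d : ℝ} (hδ : 0 < δ) (hd : δ ≤ |d|) :
    ⌊d / δ⌋ ≠ 0 ∧ δ * |(⌊d / δ⌋ : ℝ)| ≤ 2 * |d| := by
  have h1 := Int.floor_le (d / δ)
  have h2 := Int.lt_floor_add_one (d / δ)
  have hn : d = d / δ * δ := by field_simp
  set q := d / δ
  set n := ⌊q⌋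
  rcases le_abs.mp hd with h | h
  · have hq : 1 ≤ q := by rw [hn] at h; nlinarith
    have hn1 : 1 ≤ n := Int.le_floor.mpr (by simpa using hq)
    have hn1' : (1 : ℝ) ≤ n := by exact_mod_cast hn1
    refine ⟨by omega, ?_⟩
    rw [abs_of_nonneg (by linarith), abs_of_nonneg (by rw [hn]; positivity), hn]
    nlinarith
  · have hq : q ≤ -1 := by rw [hn] at h; nlinarith
    have hn1 : n ≤ -1 := by
      have : (n : ℝ) < 0 := by linarith
      have : n < 0 := by exact_mod_cast this
      omega
    refine ⟨by omega, ?_⟩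
    have hn1' : (n : ℝ) ≤ -1 := by exact_mod_cast hn1
    rw [abs_of_nonpos (by linarith), abs_of_nonpos (by rw [hn]; nlinarith), hn]
    nlinarith

/-- The bound does not depend on `F`. The term `r = s` of the sum is `0⁻¹ = 0`. -/
theorem sum_inv_sq_le {δ : ℝ} (hδ : 0 < δ) {F : Finset ℝ}
    (hF : ∀ s ∈ F, ∀ r ∈ F, s ≠ r → δ ≤ |s - r|) {s : ℝ} (hs : s ∈ F) :
    ∑ r ∈ F, ((r - s) ^ 2)⁻¹ ≤ 4 / δ ^ 2 * ∑' n : ℤ, 1 / (n : ℝ) ^ 2 := by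
  rw [← Finset.sum_erase F (a := s) (by simp)]
  have hsum : Summable fun n : ℤ => 1 / (n : ℝ) ^ 2 :=
    Real.summable_one_div_int_pow.mpr one_lt_two
  have hsep : ∀ r ∈ F.erase s, δ ≤ |r - s| := fun r hr =>
    hF r (Finset.mem_of_mem_erase hr) s hs (Finset.ne_of_mem_erase hr)
  have hinj : Set.InjOn (fun r : ℝ => ⌊(r - s) / δ⌋) (F.erase s) := by
    intro r hr t ht h
    by_contra hne
    have h1 := hF r (Finset.mem_of_mem_erase hr) t (Finset.mem_of_mem_erase ht) hne
    have h2 := Int.abs_sub_lt_one_of_floor_eq_floor h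
    rw [← sub_div, sub_sub_sub_cancel_right, abs_div, abs_of_pos hδ, div_lt_one hδ] at h2
    linarith
  calc ∑ r ∈ F.erase s, ((r - s) ^ 2)⁻¹
      ≤ ∑ r ∈ F.erase s, 4 / δ ^ 2 * (1 / (⌊(r - s) / δ⌋ : ℝ) ^ 2) := by
        refine Finset.sum_le_sum fun r hr => ?_
        obtain ⟨h0, h⟩ := abs_floor_mul_le hδ (hsep r hr)
        have h0' : (0 : ℝ) < |(⌊(r - s) / δ⌋ : ℝ)| := abs_pos.mpr (by exact_mod_cast h0)
        rw [← sq_abs (r - s), ← sq_abs (⌊(r - s) / δ⌋ : ℝ), div_mul_div_comm, mul_one,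
          ← mul_pow, inv_eq_one_div, div_le_div_iff₀ (pow_pos (hδ.trans_le (hsep r hr)) 2)
          (by positivity)]
        calc 1 * (δ * |(⌊(r - s) / δ⌋ : ℝ)|) ^ 2 ≤ 1 * (2 * |r - s|) ^ 2 := by gcongr
          _ = 4 * |r - s| ^ 2 := by ring
    _ = 4 / δ ^ 2 * ∑ n ∈ (F.erase s).image (fun r : ℝ => ⌊(r - s) / δ⌋), 1 / (n : ℝ) ^ 2 := by
        rw [Finset.sum_image hinj, Finset.mul_sum]
    _ ≤ _ := by
        gcongr
        exact hsum.sum_le_tsum _ fun n _ => by positivity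

/-- The Fourier transform of the weight `t (τ - t)` on `[0, τ]`. -/
def inghamKernel (τ s : ℝ) : ℂ :=
  ∫ t in (0 : ℝ)..τ, ((t * (τ - t) : ℝ) : ℂ) * Complex.exp (Complex.I * s * t)

theorem inghamKernel_zero (τ : ℝ) : inghamKernel τ 0 = ((τ ^ 3 / 6 : ℝ) : ℂ) := by
  have h : ∫ t in (0 : ℝ)..τ, (t * (τ - t)) = τ ^ 3 / 6 := by
    simp only [mul_sub]
    rw [intervalIntegral.integral_sub (Continuous.intervalIntegrable (by fun_prop) _ _)
      (Continuous.intervalIntegrable (by fun_prop) _ _),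
      intervalIntegral.integral_mul_const, integral_id]
    have : ∫ t in (0 : ℝ)..τ, t * t = τ ^ 3 / 3 := by
      simp only [← sq]; rw [integral_pow]; norm_num
    rw [this]; ring
  rw [inghamKernel, ← h, ← intervalIntegral.integral_ofReal]
  simp

/-- As the weight is Lipschitz and vanishes at both endpoints, its Fourier transform decays
quadratically. -/
theorem norm_inghamKernel_le {τ s : ℝ} (hτ : 0 < τ) (hs : s ≠ 0) :
    ‖inghamKernel τ s‖ ≤ 4 * τ * (s ^ 2)⁻¹ := by
  set a : ℂ := Complex.I * s with ha
  have ha0 : a ≠ 0 := mul_ne_zero Complex.I_ne_zero (by exact_mod_cast hs)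
  -- an antiderivative, found by two integrations by parts
  let G : ℝ → ℂ := fun t => ((t * (τ - t) : ℝ) : ℂ) * Complex.exp (a * t) / a
    - ((τ - 2 * t : ℝ) : ℂ) * Complex.exp (a * t) / a ^ 2 - 2 * Complex.exp (a * t) / a ^ 3
  have hG : ∀ t : ℝ, HasDerivAt G (((t * (τ - t) : ℝ) : ℂ) * Complex.exp (a * t)) t := by
    intro t
    have h1 : HasDerivAt (fun t : ℝ => (t : ℂ)) 1 t := Complex.ofRealCLM.hasDerivAt
    have h2 : HasDerivAt (fun t : ℝ => Complex.exp (a * t)) (Complex.exp (a * t) * (a * 1)) t :=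
      (h1.const_mul a).cexp
    have h3 := (((h1.mul (h1.const_sub (τ : ℂ))).mul h2).div_const a).sub
      ((((h1.const_mul 2).const_sub (τ : ℂ)).mul h2).div_const (a ^ 2))
    have h4 := h3.sub ((h2.const_mul 2).div_const (a ^ 3))
    refine (h4.congr_deriv ?_).congr_of_eventuallyEq (Eventually.of_forall fun u => ?_)
    · push_cast
      simp only [Pi.mul_apply]
      field_simp
      ring
    · simp [G]
  have hint : inghamKernel τ s = G τ - G 0 := by
    rw [inghamKernel, ← ha]
    exact intervalIntegral.integral_eq_sub_of_hasDerivAt (fun t _ => hG t)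
      (Continuous.intervalIntegrable (by fun_prop) _ _)
  have hexp : ∀ t : ℝ, ‖Complex.exp (a * t)‖ = 1 := by
    intro t
    rw [ha, mul_assoc, ← Complex.ofReal_mul, mul_comm, Complex.norm_exp_ofReal_mul_I]
  have hval : G τ - G 0 = (τ * (1 + Complex.exp (a * τ))) / a ^ 2
      - 2 * (Complex.exp (a * τ) - 1) / a ^ 3 := by
    simp only [G]
    push_cast
    simp only [mul_zero, Complex.exp_zero]
    ring
  have hna : ‖a‖ = |s| := by simp [ha]
  have hs' : 0 < |s| := abs_pos.mpr hs
  have h1 : ‖Complex.exp (a * τ) - 1‖ ≤ τ * |s| := by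
    have h := Real.norm_exp_I_mul_ofReal_sub_one_le (x := s * τ)
    rw [Real.norm_eq_abs, abs_mul, abs_of_pos hτ] at h
    rw [ha, mul_assoc, ← Complex.ofReal_mul]
    linarith
  have h2 : ‖1 + Complex.exp (a * τ)‖ ≤ 2 := by
    refine (norm_add_le _ _).trans ?_
    rw [hexp, norm_one]; norm_num
  rw [hint, hval]
  calc _ ≤ ‖(τ : ℂ) * (1 + Complex.exp (a * τ)) / a ^ 2‖
        + ‖2 * (Complex.exp (a * τ) - 1) / a ^ 3‖ := norm_sub_le _ _
    _ = τ * ‖1 + Complex.exp (a * τ)‖ / |s| ^ 2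
        + 2 * ‖Complex.exp (a * τ) - 1‖ / |s| ^ 3 := by
        simp only [norm_div, norm_mul, norm_pow, hna, Complex.norm_real, Real.norm_eq_abs,
          abs_of_pos hτ, Complex.norm_ofNat]
    _ ≤ τ * 2 / |s| ^ 2 + 2 * (τ * |s|) / |s| ^ 3 := by gcongr
    _ = 4 * τ * (s ^ 2)⁻¹ := by rw [← sq_abs s]; field_simp; ring

variable {U : Type*} [NormedAddCommGroup U] [InnerProductSpace ℂ U]

theorem integral_weight_mul_norm_sq (τ : ℝ) (F : Finset ℝ) (w : ℝ → U) :
    ((∫ t in (0 : ℝ)..τ, t * (τ - t) * ‖∑ s ∈ F, Complex.exp (Complex.I * s * t) • w s‖ ^ 2 : ℝ) : ℂ)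
      = ∑ s ∈ F, ∑ r ∈ F, inghamKernel τ (r - s) * inner ℂ (w s) (w r) := by
  rw [← intervalIntegral.integral_ofReal]
  simp only [inghamKernel, ← intervalIntegral.integral_mul_const]
  have hc : ∀ s r : ℝ, Continuous fun t : ℝ => ((t * (τ - t) : ℝ) : ℂ) *
      Complex.exp (Complex.I * (r - s : ℝ) * t) * inner ℂ (w s) (w r) := fun s r => by fun_prop
  simp only [← intervalIntegral.integral_finsetSum fun r _ => (hc _ r).intervalIntegrable 0 τ]
  rw [← intervalIntegral.integral_finsetSum fun s _ =>
    (continuous_finsetSum _ fun r _ => hc s r).intervalIntegrable 0 τ]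
  congr 1
  ext t
  have h : ((‖∑ s ∈ F, Complex.exp (Complex.I * s * t) • w s‖ ^ 2 : ℝ) : ℂ) =
      ∑ s ∈ F, ∑ r ∈ F, Complex.exp (Complex.I * (r - s : ℝ) * t) * inner ℂ (w s) (w r) := by
    rw [← inner_self_eq_ofReal, sum_inner]
    refine Finset.sum_congr rfl fun s _ => ?_
    rw [inner_sum]
    refine Finset.sum_congr rfl fun r _ => ?_
    rw [inner_smul_left, inner_smul_right, ← mul_assoc, ← Complex.exp_conj, ← Complex.exp_add]
    congr 2
    simp only [map_mul, Complex.conj_I, Complex.conj_ofReal]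
    push_cast; ring
  rw [Complex.ofReal_mul, h, Finset.mul_sum]
  simp only [Finset.mul_sum, mul_assoc]

/-- **Ingham's inequality** for finite exponential sums with coefficients in a Hilbert space. In the
double sum that expresses the weighted integral of the square, the diagonal terms dominate
once `τ` is large. -/
theorem ingham_inequality {δ τ : ℝ} (hδ : 0 < δ) (hτ : 0 < τ)
    (hτδ : 48 * (4 / δ ^ 2 * ∑' n : ℤ, 1 / (n : ℝ) ^ 2) ≤ τ ^ 2) {F : Finset ℝ}
    (hF : ∀ s ∈ F, ∀ r ∈ F, s ≠ r → δ ≤ |s - r|) (w : ℝ → U) :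
    τ / 3 * ∑ s ∈ F, ‖w s‖ ^ 2 ≤
      ∫ t in (0 : ℝ)..τ, ‖∑ s ∈ F, Complex.exp (Complex.I * s * t) • w s‖ ^ 2 := by
  set Q := 4 / δ ^ 2 * ∑' n : ℤ, 1 / (n : ℝ) ^ 2
  set W := ∑ s ∈ F, ‖w s‖ ^ 2 with hW
  set f : ℝ → U := fun t => ∑ s ∈ F, Complex.exp (Complex.I * s * t) • w s with hf
  have hfc : Continuous f := by fun_prop
  have h1 : ∫ t in (0 : ℝ)..τ, t * (τ - t) * ‖f t‖ ^ 2 ≤ τ ^ 2 / 4 * ∫ t in (0 : ℝ)..τ, ‖f t‖ ^ 2 := by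
    rw [← intervalIntegral.integral_const_mul]
    refine intervalIntegral.integral_mono_on hτ.le (Continuous.intervalIntegrable (by fun_prop) _ _)
      (Continuous.intervalIntegrable (by fun_prop) _ _) fun t _ => ?_
    gcongr
    nlinarith [sq_nonneg (t - τ / 2)]
  have hterm : ∀ s r : ℝ, (if s = r then τ ^ 3 / 6 * ‖w s‖ ^ 2 else 0)
      - 2 * τ * (((r - s) ^ 2)⁻¹ * ‖w s‖ ^ 2) - 2 * τ * (((s - r) ^ 2)⁻¹ * ‖w r‖ ^ 2)
      ≤ (inghamKernel τ (r - s) * inner ℂ (w s) (w r)).re := by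
    intro s r
    split_ifs with h
    · subst h
      rw [sub_self, inghamKernel_zero, inner_self_eq_ofReal, ← Complex.ofReal_mul, Complex.ofReal_re]
      simp
    · have hk := norm_inghamKernel_le hτ (sub_ne_zero.mpr (Ne.symm h))
      have hn := (Complex.abs_re_le_norm (inghamKernel τ (r - s) * inner ℂ (w s) (w r)))
      rw [norm_mul] at hn
      have h3 : ‖inghamKernel τ (r - s)‖ * ‖inner ℂ (w s) (w r)‖ ≤
          4 * τ * ((r - s) ^ 2)⁻¹ * (‖w s‖ * ‖w r‖) :=
        mul_le_mul hk (norm_inner_le_norm _ _) (norm_nonneg _) (by positivity)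
      have h4 : 4 * τ * ((r - s) ^ 2)⁻¹ * (‖w s‖ * ‖w r‖) ≤
          4 * τ * ((r - s) ^ 2)⁻¹ * ((‖w s‖ ^ 2 + ‖w r‖ ^ 2) / 2) := by
        gcongr
        nlinarith [sq_nonneg (‖w s‖ - ‖w r‖)]
      rw [← neg_sub r s, neg_sq]
      have h5 := neg_abs_le (inghamKernel τ (r - s) * inner ℂ (w s) (w r)).re
      linarith
  have h2 : τ ^ 3 / 6 * W - 4 * τ * (Q * W) ≤ ∫ t in (0 : ℝ)..τ, t * (τ - t) * ‖f t‖ ^ 2 := by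
    have h := congrArg Complex.re (integral_weight_mul_norm_sq τ F w)
    rw [Complex.ofReal_re, Complex.re_sum] at h
    simp only [Complex.re_sum] at h
    rw [h]
    have hQ : ∑ s ∈ F, ∑ r ∈ F, ((r - s) ^ 2)⁻¹ * ‖w s‖ ^ 2 ≤ Q * W := by
      rw [hW, Finset.mul_sum]
      refine Finset.sum_le_sum fun s hs => ?_
      rw [← Finset.sum_mul]
      gcongr
      exact sum_inv_sq_le hδ hF hs
    have hQ' : ∑ s ∈ F, ∑ r ∈ F, ((s - r) ^ 2)⁻¹ * ‖w r‖ ^ 2 ≤ Q * W := by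
      rw [Finset.sum_comm]; exact hQ
    have hsum := Finset.sum_le_sum fun s (_ : s ∈ F) => Finset.sum_le_sum fun r (_ : r ∈ F) =>
      hterm s r
    refine le_trans ?_ hsum
    simp only [Finset.sum_sub_distrib, ← Finset.mul_sum]
    have hD : ∑ s ∈ F, ∑ r ∈ F, (if s = r then τ ^ 3 / 6 * ‖w s‖ ^ 2 else 0) = τ ^ 3 / 6 * W := by
      rw [hW, Finset.mul_sum]
      exact Finset.sum_congr rfl fun s hs => by rw [Finset.sum_ite_eq, if_pos hs]
    rw [hD]
    nlinarith
  have hW0 : 0 ≤ W := Finset.sum_nonneg fun s _ => by positivity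
  have h3 : 4 * τ * (Q * W) ≤ τ ^ 3 / 12 * W := by
    have : 48 * Q * (τ * W) ≤ τ ^ 2 * (τ * W) := by gcongr
    linarith
  have h4 : τ ^ 3 / 12 * W ≤ τ ^ 2 / 4 * ∫ t in (0 : ℝ)..τ, ‖f t‖ ^ 2 := by linarith
  refine le_of_mul_le_mul_left (a := τ ^ 2 / 4) ?_ (by positivity)
  calc τ ^ 2 / 4 * (τ / 3 * W) = τ ^ 3 / 12 * W := by ring
    _ ≤ _ := h4

end Ingham

/-! ### The Gamma integral with complex rate -/

section Gamma

/-- Both sides are holomorphic in `r` on the right half-plane and agree for real `r`. The left-hand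
side is, up to the sign of `r`, the moment generating function of the measure `t ^ (β - 1) dt`
on `(0, ∞)`. -/
theorem integral_cpow_mul_exp_neg_mul {β : ℝ} (hβ : 0 < β) {r : ℂ} (hr : 0 < r.re) :
    ∫ t : ℝ in Ioi 0, (t : ℂ) ^ ((β : ℂ) - 1) * Complex.exp (-(r * t)) =
      (1 / r) ^ (β : ℂ) * Complex.Gamma β := by
  have hmeas : Measurable fun t : ℝ => (t ^ (β - 1)).toNNReal := by fun_prop
  set μ : Measure ℝ := (volume.restrict (Ioi (0 : ℝ))).withDensity
    fun t => ((t ^ (β - 1)).toNNReal : ENNReal) with hμ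
  have hmgf : ∀ z : ℂ, ProbabilityTheory.complexMGF id μ z =
      ∫ t : ℝ in Ioi 0, (t : ℂ) ^ ((β : ℂ) - 1) * Complex.exp (z * t) := by
    intro z
    rw [ProbabilityTheory.complexMGF, hμ, integral_withDensity_eq_integral_smul hmeas]
    refine setIntegral_congr_fun measurableSet_Ioi fun t ht => ?_
    have ht' : (0 : ℝ) < t := ht
    have h : ((β : ℂ) - 1) = ((β - 1 : ℝ) : ℂ) := by push_cast; rfl
    simp only [id, NNReal.smul_def, Real.coe_toNNReal _ (Real.rpow_nonneg ht'.le (β - 1))]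
    rw [h, ← Complex.ofReal_cpow ht'.le, Complex.real_smul]
  have hset : Iio (0 : ℝ) ⊆ interior (ProbabilityTheory.integrableExpSet id μ) := by
    refine interior_maximal (fun u hu => ?_) isOpen_Iio
    have hu' : 0 < -u := neg_pos.mpr hu
    change Integrable (fun t : ℝ => Real.exp (u * t)) μ
    rw [hμ, integrable_withDensity_iff_integrable_smul hmeas]
    have h := integrableOn_rpow_mul_exp_neg_mul_rpow (p := 1) (s := β - 1) (b := -u)
      (by linarith) one_pos hu'
    refine (integrableOn_congr_fun (fun t ht => ?_) measurableSet_Ioi).mp h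
    have ht' : (0 : ℝ) < t := ht
    simp only [NNReal.smul_def, Real.coe_toNNReal _ (Real.rpow_nonneg ht'.le (β - 1)), neg_neg,
      Real.rpow_one, smul_eq_mul]
  have hS : IsOpen {z : ℂ | z.re < 0} := isOpen_Iio.preimage Complex.continuous_re
  have hF : AnalyticOnNhd ℂ (ProbabilityTheory.complexMGF id μ) {z : ℂ | z.re < 0} :=
    ProbabilityTheory.analyticOnNhd_complexMGF.mono fun z hz => hset hz
  have hG : AnalyticOnNhd ℂ (fun z : ℂ => (1 / -z) ^ (β : ℂ) * Complex.Gamma β)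
      {z : ℂ | z.re < 0} := by
    refine DifferentiableOn.analyticOnNhd (fun z hz => ?_) hS
    have hz' : 0 < (-z).re := by rw [Complex.neg_re]; exact neg_pos.mpr hz
    have hz0 : -z ≠ 0 := fun h => by simp [h] at hz'
    refine DifferentiableAt.differentiableWithinAt ?_
    refine DifferentiableAt.mul_const (DifferentiableAt.cpow_const ?_ (Or.inl ?_)) _
    · exact (differentiableAt_const _).div differentiableAt_id.neg hz0
    · rw [one_div, Complex.inv_re]
      exact div_pos hz' (Complex.normSq_pos.mpr hz0)
  have heq := AnalyticOnNhd.eqOn_of_preconnected_of_frequently_eq hF hG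
    ((convex_halfSpace_re_lt 0).isPreconnected) (z₀ := ((-1 : ℝ) : ℂ)) (by simp) ?_
  · have h := heq (x := -r) (by simpa using hr)
    simp only [hmgf, neg_neg] at h
    rw [← h]
    simp only [neg_mul]
  · have h_real : ∀ᶠ x : ℝ in 𝓝[≠] (-1), ProbabilityTheory.complexMGF id μ x =
        (1 / -(x : ℂ)) ^ (β : ℂ) * Complex.Gamma β := by
      filter_upwards [nhdsWithin_le_nhds (Iio_mem_nhds (show (-1 : ℝ) < 0 by norm_num))] with x hx
      have hx' : 0 < -x := neg_pos.mpr hx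
      have h := Complex.integral_cpow_mul_exp_neg_mul_Ioi (a := β) (by simpa using hβ) hx'
      push_cast at h
      rw [hmgf, ← h]
      simp only [neg_mul, neg_neg]
    have ht : Tendsto (fun x : ℝ => (x : ℂ)) (𝓝[≠] (-1)) (𝓝[≠] ((-1 : ℝ) : ℂ)) := by
      refine tendsto_nhdsWithin_iff.mpr ⟨?_, ?_⟩
      · exact (Complex.continuous_ofReal.tendsto _).mono_left nhdsWithin_le_nhds
      · filter_upwards [self_mem_nhdsWithin] with x hx h
        exact hx (Complex.ofReal_injective h)
    exact ht.frequently h_real.frequently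

end Gamma

/-! ### Lower bound for `B*` on eigenvectors -/

section Damping

variable {X U : Type*} [NormedAddCommGroup X] [InnerProductSpace ℂ X] [CompleteSpace X]
  [NormedAddCommGroup U] [InnerProductSpace ℂ U] [CompleteSpace U] {A : X →ₗ.[ℂ] X}

/-- Let `R = (is - A_B)⁻¹`. For an eigenvector `φ` at `is` we have `R B B* φ = φ`, and
`w = R* φ` satisfies `‖B* w‖² = Re ⟪w, φ⟫`. The bound is linear in `‖R‖`, while the
estimate of `R B B* φ` by operator norms gives a bound quadratic in `‖R‖`. -/
theorem IsSkewAdjointOp.norm_sq_le_mul (hA : IsSkewAdjointOp A) (B : U →L[ℂ] X) {s : ℝ}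
    {R : X →L[ℂ] X} (hR : IsResolventAt (dampedOp A B) (Complex.I * s) R) {φ : X}
    (hφ : φ ∈ imEigenspace A s) :
    ‖φ‖ ^ 2 ≤ ‖R‖ * ‖ContinuousLinearMap.adjoint B φ‖ ^ 2 := by
  set B' := ContinuousLinearMap.adjoint B with hB'
  set w := ContinuousLinearMap.adjoint R φ with hw
  have hwx : ∀ x : A.domain,
      inner ℂ w ((Complex.I * s) • (x : X) - (A x - B (B' x))) = inner ℂ φ (x : X) := by
    intro x
    rw [hw, ContinuousLinearMap.adjoint_inner_left]
    exact congrArg (inner ℂ φ) (hR.2 x)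
  have hBB : ∀ x y : X, inner ℂ x (B (B' y)) = inner ℂ (B' x) (B' y) := fun x y =>
    (ContinuousLinearMap.adjoint_inner_left B (B' y) x).symm
  have hBB' : ∀ x y : X, inner ℂ (B (B' x)) y = inner ℂ (B' x) (B' y) := fun x y =>
    (ContinuousLinearMap.adjoint_inner_right B (B' x) y).symm
  obtain ⟨hwd, hwA⟩ := hA.exists_apply_eq (y := w)
    (w := (-(Complex.I * s)) • w + B (B' w) - φ) fun x => by
      have h := hwx x
      rw [inner_sub_right, inner_sub_right, inner_smul_right, hBB] at h
      rw [inner_sub_left, inner_add_left, inner_smul_left, hBB', map_neg, map_mul, Complex.conj_I,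
        Complex.conj_ofReal]
      linear_combination h
  have h1 : ‖B' w‖ ^ 2 = (inner ℂ w φ).re := by
    have h := hA.re_inner_apply ⟨w, hwd⟩
    rw [hwA, inner_neg_right, inner_sub_right, inner_add_right, inner_smul_right, hBB, inner_self_eq_ofReal,
      inner_self_eq_ofReal] at h
    simp only [Complex.neg_re, Complex.sub_re, Complex.add_re, Complex.ofReal_re,
      Complex.mul_re, Complex.I_re, Complex.I_im, Complex.ofReal_im] at h
    linarith
  have h2 : ‖B' w‖ ^ 2 ≤ ‖R‖ * ‖φ‖ ^ 2 := by
    rw [h1]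
    calc (inner ℂ w φ).re ≤ ‖inner ℂ w φ‖ := Complex.re_le_norm _
      _ ≤ ‖w‖ * ‖φ‖ := norm_inner_le_norm _ _
      _ ≤ (‖R‖ * ‖φ‖) * ‖φ‖ := by
          gcongr
          rw [hw, ← LinearIsometryEquiv.norm_map ContinuousLinearMap.adjoint R]
          exact ContinuousLinearMap.le_opNorm _ _
      _ = ‖R‖ * ‖φ‖ ^ 2 := by ring
  have h3 : ‖φ‖ ^ 2 ≤ ‖B' w‖ * ‖B' φ‖ := by
    obtain ⟨hφd, hφA⟩ := mem_imEigenspace_iff.mp hφ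
    have h := hwx ⟨φ, hφd⟩
    rw [hφA, sub_sub_cancel, hBB, inner_self_eq_ofReal] at h
    have h' := norm_inner_le_norm (𝕜 := ℂ) (B' w) (B' φ)
    rwa [h, Complex.norm_real, Real.norm_of_nonneg (sq_nonneg _)] at h'
  rcases eq_or_ne φ 0 with rfl | h0
  · simp
  · have hpos : 0 < ‖φ‖ ^ 2 := pow_pos (norm_pos_iff.mpr h0) 2
    refine le_of_mul_le_mul_left (a := ‖φ‖ ^ 2) ?_ hpos
    calc ‖φ‖ ^ 2 * ‖φ‖ ^ 2 ≤ (‖B' w‖ * ‖B' φ‖) * (‖B' w‖ * ‖B' φ‖) := by gcongr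
      _ = ‖B' w‖ ^ 2 * ‖B' φ‖ ^ 2 := by ring
      _ ≤ (‖R‖ * ‖φ‖ ^ 2) * ‖B' φ‖ ^ 2 := by gcongr
      _ = _ := by ring

end Damping

/-! ### The semigroup and the fractional powers on eigenvectors -/

section Semigroup

variable {X : Type*} [NormedAddCommGroup X] [NormedSpace ℂ X] {A : X →ₗ.[ℂ] X}

/-- Orbits of points of `D(A)` are differentiable from the right. -/
theorem IsGenerator.hasDerivWithinAt {T : ContractionSemigroup X} (hAT : IsGenerator A T)
    (x : A.domain) {t : ℝ} (ht : 0 ≤ t) :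
    HasDerivWithinAt (fun r => T.op r x) (T.op t (A x)) (Ici t) t := by
  rw [← hasDerivWithinAt_Ioi_iff_Ici, hasDerivWithinAt_iff_tendsto_slope' (by simp)]
  have h1 := (hAT x (A x)).mp (LinearPMap.mem_graph A x)
  have h2 : Tendsto (fun r : ℝ => r - t) (𝓝[>] t) (𝓝[>] 0) := by
    refine tendsto_nhdsWithin_iff.mpr ⟨?_, ?_⟩
    · have : Tendsto (fun r : ℝ => r - t) (𝓝 t) (𝓝 (t - t)) := by
        exact (continuous_id.sub continuous_const).tendsto t
      rw [sub_self] at this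
      exact this.mono_left nhdsWithin_le_nhds
    · filter_upwards [self_mem_nhdsWithin] with r hr
      exact sub_pos.mpr (mem_Ioi.mp hr)
  refine (((T.op t).continuous.tendsto (A x)).comp (h1.comp h2)).congr' ?_
  filter_upwards [self_mem_nhdsWithin] with r hr
  have hr' : t < r := hr
  have h3 := T.op_add t (r - t) ht (sub_nonneg.mpr hr'.le)
  rw [add_sub_cancel] at h3
  simp only [Function.comp_apply, slope_def_module, map_smul, map_sub, h3,
    ContinuousLinearMap.comp_apply]
  rw [← Complex.ofReal_inv, Complex.coe_smul]

end Semigroup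

section SemigroupEigen

variable {X : Type*} [NormedAddCommGroup X] [InnerProductSpace ℂ X] {A : X →ₗ.[ℂ] X}

theorem IsGenerator.op_apply {T : ContractionSemigroup X} (hAT : IsGenerator A T)
    {s : ℝ} {x : X} (hx : x ∈ imEigenspace A s) {t : ℝ} (ht : 0 ≤ t) :
    T.op t x = Complex.exp (Complex.I * s * t) • x := by
  obtain ⟨hd, hAx⟩ := mem_imEigenspace_iff.mp hx
  have h := constant_of_has_deriv_right_zero (a := 0) (b := t)
    (f := fun r : ℝ => Complex.exp (-(Complex.I * s) * r) • T.op r x) ?_ ?_ t ⟨ht, le_rfl⟩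
  · simp only [Complex.ofReal_zero, mul_zero, Complex.exp_zero, one_smul, T.op_zero,
      ContinuousLinearMap.id_apply] at h
    nth_rewrite 2 [← h]
    rw [smul_smul, ← Complex.exp_add]
    simp
  · refine ContinuousOn.smul (Continuous.continuousOn (by fun_prop)) ?_
    exact (T.continuousOn_op x).mono Icc_subset_Ici_self
  · intro r hr
    have h1 := hAT.hasDerivWithinAt ⟨x, hd⟩ hr.1
    have h2 : HasDerivAt (fun r : ℝ => (r : ℂ)) 1 r := Complex.ofRealCLM.hasDerivAt
    have h3 := ((h2.const_mul (-(Complex.I * s))).cexp.hasDerivWithinAt (s := Ici r)).smul h1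
    refine h3.congr_deriv ?_
    rw [hAx, map_smul]
    module

/-- On the eigenspace at `is`, the operator `(I - A)^{-β}` is multiplication by `(1 - is)^{-β}`. -/
theorem IsGenerator.negFracPow_apply [CompleteSpace X] {T : ContractionSemigroup X} (hAT : IsGenerator A T) {β : ℝ}
    (hβ : 0 < β) {s : ℝ} {x : X} (hx : x ∈ imEigenspace A s) :
    negFracPow T β x = (1 / (1 - Complex.I * s) : ℂ) ^ (β : ℂ) • x := by
  have h1 : ∀ t ∈ Ioi (0 : ℝ), (t ^ (β - 1) * Real.exp (-t)) • T.op t x =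
      ((t : ℂ) ^ ((β : ℂ) - 1) * Complex.exp (-((1 - Complex.I * s) * t))) • x := by
    intro t ht
    have ht' : (0 : ℝ) < t := ht
    rw [hAT.op_apply hx ht'.le, ← Complex.coe_smul, smul_smul]
    congr 1
    push_cast
    rw [Complex.ofReal_cpow ht'.le, mul_assoc, ← Complex.exp_add]
    push_cast
    congr 2
    ring
  rw [negFracPow, setIntegral_congr_fun measurableSet_Ioi h1, integral_smul_const,
    integral_cpow_mul_exp_neg_mul hβ (by simp), ← Complex.coe_smul,
    smul_smul, Complex.Gamma_ofReal]
  congr 1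
  have := (Real.Gamma_pos_of_pos hβ).ne'
  have h2 : (Real.Gamma β : ℂ) ≠ 0 := by exact_mod_cast this
  push_cast
  field_simp

end SemigroupEigen

/-! ### Passage to the limit and the observability estimate -/

section Continuity

variable {X : Type*} [NormedAddCommGroup X] [NormedSpace ℂ X]

theorem ContractionSemigroup.norm_op_apply_le (T : ContractionSemigroup X) {t : ℝ} (ht : 0 ≤ t)
    (x : X) : ‖T.op t x‖ ≤ ‖x‖ := by
  simpa using (T.op t).le_of_opNorm_le (T.norm_op_le t ht) x

theorem eventually_norm_le_add_one {E : Type*} [NormedAddCommGroup E] (x₀ : E) :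
    ∀ᶠ x in 𝓝 x₀, ‖x‖ ≤ ‖x₀‖ + 1 :=
  (continuous_norm.continuousAt.eventually_lt_const (lt_add_one ‖x₀‖)).mono fun _ h => h.le

theorem continuous_negFracPow (T : ContractionSemigroup X) {β : ℝ} (hβ : 0 < β) :
    Continuous (negFracPow T β) := by
  refine Continuous.const_smul (continuous_iff_continuousAt.mpr fun x₀ => ?_) _
  have hg : IntegrableOn (fun t : ℝ => Real.exp (-t) * t ^ (β - 1)) (Ioi 0) :=
    Real.GammaIntegral_convergent hβ
  refine continuousAt_of_dominated
    (bound := fun t => Real.exp (-t) * t ^ (β - 1) * (‖x₀‖ + 1)) ?_ ?_ (hg.mul_const _) ?_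
  · exact Eventually.of_forall fun x => (integrableOn_negFracPow T hβ x).aestronglyMeasurable
  · filter_upwards [eventually_norm_le_add_one x₀] with x hx
    filter_upwards [ae_restrict_mem measurableSet_Ioi] with t ht
    have ht' : (0 : ℝ) < t := ht
    have h0 : 0 ≤ t ^ (β - 1) * Real.exp (-t) := by positivity
    rw [norm_smul, Real.norm_of_nonneg h0, mul_comm (Real.exp (-t))]
    exact mul_le_mul_of_nonneg_left ((T.norm_op_apply_le ht'.le x).trans hx) h0
  · exact Eventually.of_forall fun t => by fun_prop

theorem negFracPow_sum (T : ContractionSemigroup X) {β : ℝ} (hβ : 0 < β) {ι : Type*}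
    (F : Finset ι) (v : ι → X) :
    negFracPow T β (∑ i ∈ F, v i) = ∑ i ∈ F, negFracPow T β (v i) := by
  simp only [negFracPow, map_sum, Finset.smul_sum]
  rw [integral_finsetSum F fun i _ => integrableOn_negFracPow T hβ (v i), Finset.smul_sum]

variable {U : Type*} [NormedAddCommGroup U] [NormedSpace ℂ U]

theorem continuous_integral_norm_sq (T : ContractionSemigroup X) (L : X →L[ℂ] U) {τ : ℝ}
    (hτ : 0 ≤ τ) : Continuous fun x => ∫ t in (0 : ℝ)..τ, ‖L (T.op t x)‖ ^ 2 := by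
  refine continuous_iff_continuousAt.mpr fun x₀ => ?_
  refine intervalIntegral.continuousAt_of_dominated_interval
    (bound := fun _ => (‖L‖ * (‖x₀‖ + 1)) ^ 2) ?_ ?_ intervalIntegrable_const ?_
  · refine Eventually.of_forall fun x => ?_
    rw [uIoc_of_le hτ]
    refine ContinuousOn.aestronglyMeasurable ?_ measurableSet_Ioc
    have h : ContinuousOn (fun t => T.op t x) (Ioc 0 τ) :=
      (T.continuousOn_op x).mono fun t ht => ht.1.le
    exact (L.continuous.comp_continuousOn h).norm.pow 2
  · filter_upwards [eventually_norm_le_add_one x₀] with x hx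
    refine Eventually.of_forall fun t ht => ?_
    rw [uIoc_of_le hτ] at ht
    rw [Real.norm_of_nonneg (sq_nonneg _)]
    gcongr
    exact (L.le_opNorm _).trans
      (mul_le_mul_of_nonneg_left ((T.norm_op_apply_le ht.1.le x).trans hx) (norm_nonneg _))
  · exact Eventually.of_forall fun t _ => by fun_prop

end Continuity

/-- The decay of the multiplier of `(I - A)^{-α/2}` compensates the growth `1 + |s| ^ α` of
the resolvent. -/
theorem norm_sq_cpow_mul_le {α : ℝ} (hα : 0 < α) (s : ℝ) :
    ‖(1 / (1 - Complex.I * s) : ℂ) ^ ((α / 2 : ℝ) : ℂ)‖ ^ 2 * (1 + |s| ^ α) ≤ 2 := by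
  set m := ‖(1 - Complex.I * s : ℂ)‖ with hm
  have h1 : 1 ≤ m := by
    have h := Complex.abs_re_le_norm (1 - Complex.I * s : ℂ)
    simpa using h
  have h2 : |s| ≤ m := by
    have h := Complex.abs_im_le_norm (1 - Complex.I * s : ℂ)
    simpa using h
  have hm0 : 0 < m := by linarith
  have h3 : ‖(1 / (1 - Complex.I * s) : ℂ) ^ ((α / 2 : ℝ) : ℂ)‖ ^ 2 = (m ^ α)⁻¹ := by
    rw [Complex.norm_cpow_real, norm_div, norm_one, ← hm, one_div,
      ← Real.rpow_natCast, ← Real.rpow_mul (by positivity), Real.inv_rpow hm0.le]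
    norm_num
  have h4 : 1 ≤ m ^ α := Real.one_le_rpow h1 hα.le
  have h5 : |s| ^ α ≤ m ^ α := Real.rpow_le_rpow (abs_nonneg s) h2 hα.le
  rw [h3, inv_mul_le_iff₀ (by positivity)]
  linarith

section Observability

variable {X U : Type*} [NormedAddCommGroup X] [InnerProductSpace ℂ X] [CompleteSpace X]
  [NormedAddCommGroup U] [InnerProductSpace ℂ U] {A : X →ₗ.[ℂ] X}

/-- The observability estimate for finite sums of eigenvectors, where `L` stands for `B*`. -/
theorem IsSkewAdjointOp.observability_sum (hA : IsSkewAdjointOp A) {T : ContractionSemigroup X}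
    (hAT : IsGenerator A T) (L : X →L[ℂ] U) {α C δ τ : ℝ} (hα : 0 < α) (hC : 0 < C) (hδ : 0 < δ)
    (hτ : 0 < τ) (hτδ : 48 * (4 / δ ^ 2 * ∑' n : ℤ, 1 / (n : ℝ) ^ 2) ≤ τ ^ 2)
    (hL : ∀ s : ℝ, ∀ φ ∈ imEigenspace A s, ‖φ‖ ^ 2 ≤ C * (1 + |s| ^ α) * ‖L φ‖ ^ 2)
    {F : Finset ℝ} (hF : ∀ s ∈ F, ∀ r ∈ F, s ≠ r → δ ≤ |s - r|) {v : ℝ → X}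
    (hv : ∀ s, v s ∈ imEigenspace A s) :
    τ / (6 * C) * ‖negFracPow T (α / 2) (∑ s ∈ F, v s)‖ ^ 2 ≤
      ∫ t in (0 : ℝ)..τ, ‖L (T.op t (∑ s ∈ F, v s))‖ ^ 2 := by
  let c : ℝ → ℂ := fun s => (1 / (1 - Complex.I * s) : ℂ) ^ ((α / 2 : ℝ) : ℂ)
  have horth : OrthogonalFamily ℂ (fun s => imEigenspace A s)
      fun s => (imEigenspace A s).subtypeₗᵢ := fun s r hsr x y =>
    hA.inner_eq_zero hsr x.2 y.2
  have h1 : ‖negFracPow T (α / 2) (∑ s ∈ F, v s)‖ ^ 2 = ∑ s ∈ F, ‖c s‖ ^ 2 * ‖v s‖ ^ 2 := by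
    rw [negFracPow_sum T (by positivity)]
    have h := horth.norm_sum (fun s => c s • ⟨v s, hv s⟩) F
    simp only [Submodule.coe_subtypeₗᵢ, Submodule.subtype_apply, Submodule.coe_smul, norm_smul,
      mul_pow, Submodule.coe_norm] at h
    rw [← h]
    congr 2
    exact Finset.sum_congr rfl fun s _ => hAT.negFracPow_apply (by positivity) (hv s)
  have h2 : ∑ s ∈ F, ‖c s‖ ^ 2 * ‖v s‖ ^ 2 ≤ 2 * C * ∑ s ∈ F, ‖L (v s)‖ ^ 2 := by
    rw [Finset.mul_sum]
    refine Finset.sum_le_sum fun s _ => ?_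
    calc ‖c s‖ ^ 2 * ‖v s‖ ^ 2 ≤ ‖c s‖ ^ 2 * (C * (1 + |s| ^ α) * ‖L (v s)‖ ^ 2) := by
          gcongr; exact hL s _ (hv s)
      _ = ‖c s‖ ^ 2 * (1 + |s| ^ α) * (C * ‖L (v s)‖ ^ 2) := by ring
      _ ≤ 2 * (C * ‖L (v s)‖ ^ 2) := by gcongr; exact norm_sq_cpow_mul_le hα s
      _ = _ := by ring
  have h3 := ingham_inequality hδ hτ hτδ hF fun s => L (v s)
  have h4 : ∫ t in (0 : ℝ)..τ, ‖L (T.op t (∑ s ∈ F, v s))‖ ^ 2 =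
      ∫ t in (0 : ℝ)..τ, ‖∑ s ∈ F, Complex.exp (Complex.I * s * t) • L (v s)‖ ^ 2 := by
    refine intervalIntegral.integral_congr fun t ht => ?_
    rw [uIcc_of_le hτ.le] at ht
    simp only [map_sum, hAT.op_apply (hv _) ht.1, map_smul]
  rw [h4, h1]
  refine le_trans ?_ h3
  calc τ / (6 * C) * ∑ s ∈ F, ‖c s‖ ^ 2 * ‖v s‖ ^ 2
      ≤ τ / (6 * C) * (2 * C * ∑ s ∈ F, ‖L (v s)‖ ^ 2) := by gcongr
    _ = τ / 3 * ∑ s ∈ F, ‖L (v s)‖ ^ 2 := by field_simp; ring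

end Observability

end SemiLinearDamping

end

theorem proposition2p4
    {X U : Type*}
    [NormedAddCommGroup X] [InnerProductSpace ℂ X] [CompleteSpace X]
    [NormedAddCommGroup U] [InnerProductSpace ℂ U] [CompleteSpace U]
    (A : X →ₗ.[ℂ] X) (T : SemiLinearDamping.ContractionSemigroup X)
    (hAT : SemiLinearDamping.IsGenerator A T)
    (B : U →L[ℂ] X)
    (hA : SemiLinearDamping.IsSkewAdjointOp A)
    (hsimple : SemiLinearDamping.SpectrumSimpleEigenvalues A)
    (hsep : SemiLinearDamping.SpectrumUniformlySeparated A)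
    (α : ℝ) (hα : 0 < α)
    (hρ : ∀ s : ℝ, Complex.I * (s : ℂ) ∈
      SemiLinearDamping.resolventSet (SemiLinearDamping.dampedOp A B))
    (hres : ∃ C : ℝ, 0 < C ∧ ∀ s : ℝ,
      ‖SemiLinearDamping.resolventOp (SemiLinearDamping.dampedOp A B) (Complex.I * (s : ℂ))‖
        ≤ C * (1 + |s| ^ α)) :
    ∃ τ c : ℝ, 0 < τ ∧ 0 < c ∧ ∀ x₀ : X,
      c * ‖SemiLinearDamping.negFracPow T (α / 2) x₀‖ ^ 2
        ≤ ∫ t in (0 : ℝ)..τ, ‖ContinuousLinearMap.adjoint B (T.op t x₀)‖ ^ 2 := by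
  obtain ⟨C, hC, hCs⟩ := hres
  have hdense := hA.dense_iSup_imEigenspace hsep
  obtain ⟨δ, hδ, hδs⟩ := hsep
  set Q : ℝ := 48 * (4 / δ ^ 2 * ∑' n : ℤ, 1 / (n : ℝ) ^ 2) with hQ
  have hQ0 : 0 ≤ Q := mul_nonneg (by norm_num)
    (mul_nonneg (by positivity) (tsum_nonneg fun n => by positivity))
  have hτ : 0 < Q + 1 := by linarith
  refine ⟨Q + 1, (Q + 1) / (6 * C), hτ, by positivity, ?_⟩
  have hL : ∀ s : ℝ, ∀ φ ∈ SemiLinearDamping.imEigenspace A s,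
      ‖φ‖ ^ 2 ≤ C * (1 + |s| ^ α) * ‖ContinuousLinearMap.adjoint B φ‖ ^ 2 := fun s φ hφ =>
    (hA.norm_sq_le_mul B (SemiLinearDamping.isResolventAt_resolventOp (hρ s)) hφ).trans
      (mul_le_mul_of_nonneg_right (hCs s) (sq_nonneg _))
  have hclosed : IsClosed {x : X |
      (Q + 1) / (6 * C) * ‖SemiLinearDamping.negFracPow T (α / 2) x‖ ^ 2 ≤
        ∫ t in (0 : ℝ)..(Q + 1), ‖ContinuousLinearMap.adjoint B (T.op t x)‖ ^ 2} :=
    isClosed_le (continuous_const.mul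
      ((SemiLinearDamping.continuous_negFracPow T (by positivity)).norm.pow 2))
      (SemiLinearDamping.continuous_integral_norm_sq T _ hτ.le)
  intro x₀
  refine closure_minimal ?_ hclosed (hdense x₀)
  intro x hx
  obtain ⟨v, hv, rfl⟩ := (Submodule.mem_iSup_iff_exists_finsupp _ x).mp hx
  refine hA.observability_sum hAT _ hα hC hδ hτ (by rw [← hQ]; nlinarith) hL ?_ hv
  intro s hs r hr hsr
  have h := hδs _
    (SemiLinearDamping.mem_spectrumSet_of_mem_imEigenspace (hv s) (Finsupp.mem_support_iff.mp hs)) _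
    (SemiLinearDamping.mem_spectrumSet_of_mem_imEigenspace (hv r) (Finsupp.mem_support_iff.mp hr))
    (by simpa using hsr)
  rw [← mul_sub, norm_mul, Complex.norm_I, one_mul, ← Complex.ofReal_sub, Complex.norm_real] at h
  exact h
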